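/- A tiling of the plane is a countable collection of compact subsets of $\mathbb{R}^2$ (the tiles) whose union is $\mathbb{R}^2$ and such that distinct tiles have disjoint interiors. It is normal if there are $R>r>0$ such that each tile contains some ball of radius $r$ and is contained in some ball of radius $R$. (1) There is a normal tiling of the plane by pairwise non-congruent (nondegenerate) triangles of unit area, in which every triangle moreover has perimeter less than $100$. Here two sets are congruent if some isometry of the plane, possibly orientation reversing, maps one onto the other. (2) A tiling of the plane by triangles of unit area is normal if and only if the perimeters of its triangles are bounded by a common constant. -/

import Mathlib

namespace PlaneTiling

/-- The Euclidean plane. -/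
abbrev Plane : Type := EuclideanSpace ℝ (Fin 2)

/-- A tiling of the plane: a countable collection of compact sets (the tiles) such that the
interiors of distinct tiles are disjoint and the union of the tiles is the whole plane. -/
structure IsTiling (𝒯 : Set (Set Plane)) : Prop where
  countable : 𝒯.Countable
  isCompact : ∀ T ∈ 𝒯, IsCompact T
  packing : ∀ S ∈ 𝒯, ∀ T ∈ 𝒯, S ≠ T → Disjoint (interior S) (interior T)
  covering : ⋃₀ 𝒯 = Set.univ

/-- A collection of sets is normal if there are `R > r > 0` such that each of the sets contains
some ball of radius `r` and is contained in some ball of radius `R`. -/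
def IsNormal (𝒯 : Set (Set Plane)) : Prop :=
  ∃ r R : ℝ, 0 < r ∧ r < R ∧ ∀ T ∈ 𝒯,
    (∃ x : Plane, Metric.closedBall x r ⊆ T) ∧ (∃ y : Plane, T ⊆ Metric.closedBall y R)

/-- The set `T` is a (filled, nondegenerate) triangle with vertices the three affinely independent
points of `t`. -/
def IsTriangleWith (T : Set Plane) (t : Affine.Triangle ℝ Plane) : Prop :=
  T = convexHull ℝ (Set.range t.points)

/-- The set `T` is a (filled, nondegenerate) triangle. -/
def IsTriangle (T : Set Plane) : Prop :=
  ∃ t : Affine.Triangle ℝ Plane, IsTriangleWith T t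

/-- The set `T` is a triangle, and the sum of its three side lengths is `p`. -/
def HasPerimeter (T : Set Plane) (p : ℝ) : Prop :=
  ∃ t : Affine.Triangle ℝ Plane, IsTriangleWith T t ∧
    p = dist (t.points 0) (t.points 1) + dist (t.points 1) (t.points 2) +
      dist (t.points 2) (t.points 0)

/-- Congruence of subsets of the plane: some isometry of the plane (possibly orientation
reversing) maps one onto the other. -/
def AreCongruent (S T : Set Plane) : Prop :=
  ∃ f : Plane ≃ᵢ Plane, f '' S = T

/-- A tiling of the plane by triangles of unit area. -/
def IsUnitTriangleTiling (𝒯 : Set (Set Plane)) : Prop :=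
  IsTiling 𝒯 ∧ ∀ T ∈ 𝒯, IsTriangle T ∧ MeasureTheory.volume T = 1

end PlaneTiling

/-!
A normal family of triangles of area at least `a` has bounded perimeters because a triangle inside a
ball of radius `R` has perimeter at most `6 * R`. Conversely, the distance from the centroid to each
side is a third of an altitude, hence at least `2 * a / (3 * c)` if the perimeters are at most `c`.

For the existence, the plane is cut into horizontal rows of height `1` and each row into trapezoids.
The trapezoid with parallel sides `5 - √5` and `5 + √5` is dissected into five triangles of area `1`
that have distinct sums of squared vertical side components. Its lower side is too short by
`2 * √5`, not a multiple of the base length `2` of the triangles of height and area `1` that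
compensate for this, so the blocks of a row lean by varying amounts. These are twice the fractional
parts of `s + p * √5`, with `s` depending on the row; they are pairwise distinct for distinct
rational `s` in `(0, 1)` since `√5` is irrational.

The sum of the squared side lengths, a congruence invariant, depends quadratically on the parameter
`μ` of a horizontal shear of the whole tiling. The leading coefficient and the lean together ensure
that no two tiles have the same quadratic, so all but countably many `μ` tell all tiles apart.
-/

namespace PlaneTiling

open MeasureTheory

section Simplices

variable {E ι : Type*} [NormedAddCommGroup E] [NormedSpace ℝ E]

theorem extremePoints_convexHull_range [Finite ι] {p : ι → E} (hp : AffineIndependent ℝ p) :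
    (convexHull ℝ (Set.range p)).extremePoints ℝ = Set.range p := by
  refine extremePoints_convexHull_subset.antisymm ?_
  rintro _ ⟨i, rfl⟩
  by_contra hi
  set X := (convexHull ℝ (Set.range p)).extremePoints ℝ
  have hX : X ⊆ p '' {i}ᶜ := fun x hx => by
    obtain ⟨j, rfl⟩ := extremePoints_convexHull_subset hx
    exact ⟨j, fun hj => hi (hj ▸ hx), rfl⟩
  have krein_milman : convexHull ℝ X = convexHull ℝ (Set.range p) := by
    rw [← ((Set.toFinite (p '' {i}ᶜ)).subset hX |>.isClosed_convexHull (𝕜 := ℝ)).closure_eq]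
    exact closure_convexHull_extremePoints ((Set.finite_range p).isCompact_convexHull (𝕜 := ℝ))
      (convex_convexHull ℝ _)
  have hmem : p i ∈ affineSpan ℝ (p '' {i}ᶜ) :=
    convexHull_subset_affineSpan _ <| convexHull_mono hX <|
      krein_milman ▸ subset_convexHull ℝ _ ⟨i, rfl⟩
  simp [hp.mem_affineSpan_iff] at hmem

theorem exists_perm_of_image_convexHull_eq [Finite ι] {p q : ι → E} (hp : AffineIndependent ℝ p)
    (hq : AffineIndependent ℝ q) (f : E ≃ᵢ E)
    (hf : f '' convexHull ℝ (Set.range p) = convexHull ℝ (Set.range q)) :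
    ∃ σ : Equiv.Perm ι, ∀ i, q (σ i) = f (p i) := by
  let g := f.toRealAffineIsometryEquiv.toAffineEquiv
  have hg : ⇑g = f := f.coeFn_toRealAffineIsometryEquiv
  have hfp : AffineIndependent ℝ (f ∘ p) := hg ▸ g.affineIndependent_iff.2 hp
  have hrange : Set.range (f ∘ p) = Set.range q := by
    rw [← extremePoints_convexHull_range hfp, ← extremePoints_convexHull_range hq, ← hf,
      Set.range_comp, ← hg]
    exact congrArg _ (g.toAffineMap.image_convexHull _).symm
  let σ := (Equiv.ofInjective _ hfp.injective).trans
    ((Equiv.setCongr hrange).trans (Equiv.ofInjective _ hq.injective).symm)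
  exact ⟨σ, fun i => Equiv.apply_ofInjective_symm hq.injective _⟩

/-- The sum of the squared distances over all ordered pairs of members of a finite family. For the
vertices of a triangle it is twice the sum of the squares of the side lengths. -/
noncomputable def sumSqDist [Fintype ι] (p : ι → E) : ℝ := ∑ i, ∑ j, dist (p i) (p j) ^ 2

theorem sumSqDist_eq_of_image_convexHull_eq [Fintype ι] {p q : ι → E}
    (hp : AffineIndependent ℝ p) (hq : AffineIndependent ℝ q) (f : E ≃ᵢ E)
    (hf : f '' convexHull ℝ (Set.range p) = convexHull ℝ (Set.range q)) :
    sumSqDist p = sumSqDist q := by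
  obtain ⟨σ, hσ⟩ := exists_perm_of_image_convexHull_eq hp hq f hf
  calc sumSqDist p = ∑ i, ∑ j, dist (q (σ i)) (q (σ j)) ^ 2 := by
        simp only [sumSqDist, hσ, f.dist_eq]
    _ = ∑ i, ∑ j, dist (q (σ i)) (q j) ^ 2 :=
        Finset.sum_congr rfl fun i _ => Equiv.sum_comp σ fun j => dist (q (σ i)) (q j) ^ 2
    _ = sumSqDist q := Equiv.sum_comp σ fun i => ∑ j, dist (q i) (q j) ^ 2

theorem lt_of_mem_interior_of_le {f : StrongDual ℝ E} (hf : f ≠ 0) {c : ℝ} {S : Set E}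
    (hS : ∀ x ∈ S, c ≤ f x) {x : E} (hx : x ∈ interior S) : c < f x := by
  have hsub : interior S ⊆ interior (f ⁻¹' Set.Ici c) := interior_mono hS
  rw [← (f.isOpenMap_of_ne_zero hf).preimage_interior_eq_interior_preimage f.continuous,
    interior_Ici] at hsub
  exact hsub hx

theorem disjoint_interior_convexHull_of_le_of_le {f : StrongDual ℝ E} (hf : f ≠ 0) {c : ℝ}
    {S T : Set E} (hS : ∀ x ∈ S, c ≤ f x) (hT : ∀ x ∈ T, f x ≤ c) :
    Disjoint (interior (convexHull ℝ S)) (interior (convexHull ℝ T)) := by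
  have hS' : convexHull ℝ S ⊆ {x | c ≤ f x} :=
    convexHull_min hS (convex_halfSpace_ge f.isLinear c)
  have hT' : convexHull ℝ T ⊆ {x | f x ≤ c} :=
    convexHull_min hT (convex_halfSpace_le f.isLinear c)
  refine Set.disjoint_left.2 fun x hxS hxT => ?_
  exact (lt_of_mem_interior_of_le hf hS' hxS).not_ge (hT' (interior_subset hxT))

end Simplices

section Orientation

theorem plane_ext {x y : Plane} (h0 : x 0 = y 0) (h1 : x 1 = y 1) : x = y :=
  PiLp.ext <| Fin.forall_fin_two.2 ⟨h0, h1⟩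

theorem dist_sq_eq (x y : Plane) : dist x y ^ 2 = (x 0 - y 0) ^ 2 + (x 1 - y 1) ^ 2 := by
  rw [EuclideanSpace.dist_sq_eq, Fin.sum_univ_two, Real.dist_eq, Real.dist_eq, sq_abs, sq_abs]

/-- Twice the signed area of the triangle `a`, `b`, `c`; as a function of `c`, an affine function
that is positive to the left of the line from `a` to `b`. -/
def orient (a b c : Plane) : ℝ := (b 0 - a 0) * (c 1 - a 1) - (b 1 - a 1) * (c 0 - a 0)

@[simp] theorem orient_self_left (a c : Plane) : orient a a c = 0 := by simp [orient]

@[simp] theorem orient_self_right (a b : Plane) : orient a b b = 0 := by rw [orient]; ring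

@[simp] theorem orient_self_outer (a b : Plane) : orient a b a = 0 := by simp [orient]

theorem orient_swap_left (a b c : Plane) : orient b a c = -orient a b c := by
  simp only [orient]; ring

theorem orient_swap_right (a b c : Plane) : orient a c b = -orient a b c := by
  simp only [orient]; ring

theorem abs_orient_sub_orient_le (a b z w : Plane) :
    |orient a b z - orient a b w| ≤ dist a b * dist z w := by
  refine abs_le_of_sq_le_sq ?_ (by positivity)
  rw [mul_pow, dist_sq_eq, dist_sq_eq]
  unfold orient
  nlinarith [sq_nonneg ((b 0 - a 0) * (z 0 - w 0) + (b 1 - a 1) * (z 1 - w 1))]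

theorem affineIndependent_of_orient_ne_zero {p : Fin 3 → Plane}
    (hp : orient (p 0) (p 1) (p 2) ≠ 0) : AffineIndependent ℝ p := by
  rw [affineIndependent_iff_of_fintype]
  intro w hw hv
  rw [Finset.univ.weightedVSub_eq_linear_combination hw] at hv
  have hx := congrArg (fun v : Plane => v 0) hv
  have hy := congrArg (fun v : Plane => v 1) hv
  simp only [Fin.sum_univ_three, PiLp.add_apply, PiLp.smul_apply, smul_eq_mul,
    PiLp.zero_apply] at hw hx hy
  have h0 : w 0 * orient (p 0) (p 1) (p 2) = 0 := by
    unfold orient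
    linear_combination (p 1 0 * p 2 1 - p 2 0 * p 1 1) * hw + (p 1 1 - p 2 1) * hx +
      (p 2 0 - p 1 0) * hy
  have h1 : w 1 * orient (p 0) (p 1) (p 2) = 0 := by
    unfold orient
    linear_combination (p 2 0 * p 0 1 - p 0 0 * p 2 1) * hw + (p 2 1 - p 0 1) * hx +
      (p 0 0 - p 2 0) * hy
  have h2 : w 2 * orient (p 0) (p 1) (p 2) = 0 := by
    unfold orient
    linear_combination (p 0 0 * p 1 1 - p 1 0 * p 0 1) * hw + (p 0 1 - p 1 1) * hx +
      (p 1 0 - p 0 0) * hy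
  have cramer : ∀ i, w i * orient (p 0) (p 1) (p 2) = 0 :=
    Fin.forall_fin_succ.2 ⟨h0, Fin.forall_fin_two.2 ⟨h1, h2⟩⟩
  exact fun i => (mul_eq_zero.1 (cramer i)).resolve_right hp

theorem mem_convexHull_of_orient_div_nonneg {p : Fin 3 → Plane} {z : Plane}
    (hp : orient (p 0) (p 1) (p 2) ≠ 0)
    (h0 : 0 ≤ orient (p 1) (p 2) z / orient (p 0) (p 1) (p 2))
    (h1 : 0 ≤ orient (p 2) (p 0) z / orient (p 0) (p 1) (p 2))
    (h2 : 0 ≤ orient (p 0) (p 1) z / orient (p 0) (p 1) (p 2)) :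
    z ∈ convexHull ℝ (Set.range p) := by
  set D := orient (p 0) (p 1) (p 2) with hD
  refine mem_convexHull_of_exists_fintype
    ![orient (p 1) (p 2) z / D, orient (p 2) (p 0) z / D, orient (p 0) (p 1) z / D] p
    (Fin.forall_fin_succ.2 ⟨h0, Fin.forall_fin_two.2 ⟨h1, h2⟩⟩) ?_ (Set.mem_range_self ·) ?_
  · simp only [Fin.sum_univ_three, Matrix.cons_val]
    rw [← add_div, ← add_div, div_eq_one_iff_eq hp, hD]
    unfold orient; ring
  · apply plane_ext <;> simp only [Fin.sum_univ_three, Matrix.cons_val, PiLp.add_apply,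
      PiLp.smul_apply, smul_eq_mul] <;> field_simp <;> rw [hD] <;> unfold orient <;> ring

theorem closedBall_centroid_subset_convexHull {p : Fin 3 → Plane} {c : ℝ}
    (hp : orient (p 0) (p 1) (p 2) ≠ 0) (hc : ∀ i j, dist (p i) (p j) ≤ c) :
    Metric.closedBall ((1 / 3 : ℝ) • (p 0 + p 1 + p 2)) (|orient (p 0) (p 1) (p 2)| / (3 * c)) ⊆
      convexHull ℝ (Set.range p) := by
  set D := orient (p 0) (p 1) (p 2) with hD
  set g := (1 / 3 : ℝ) • (p 0 + p 1 + p 2) with hg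
  have hc0 : 0 < c := by
    refine (dist_pos.2 fun h => hp ?_).trans_le (hc 0 1)
    rw [hD, h, orient_self_left]
  intro z hz
  have hside : ∀ i j, orient (p i) (p j) g = D / 3 → 0 ≤ orient (p i) (p j) z / D := by
    intro i j hij
    have hdev : |orient (p i) (p j) z / D - 1 / 3| ≤ 1 / 3 := by
      calc |orient (p i) (p j) z / D - 1 / 3|
          = |orient (p i) (p j) z - orient (p i) (p j) g| / |D| := by
            rw [hij, ← abs_div]; congr 1; field_simp
        _ ≤ c * (|D| / (3 * c)) / |D| := by
            gcongr
            exact (abs_orient_sub_orient_le _ _ _ _).trans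
              (mul_le_mul (hc i j) hz dist_nonneg hc0.le)
        _ = 1 / 3 := by field_simp [abs_ne_zero.2 hp]
    linarith [(abs_le.1 hdev).1]
  refine mem_convexHull_of_orient_div_nonneg hp (hside 1 2 ?_) (hside 2 0 ?_) (hside 0 1 ?_) <;>
    simp [hg, hD, orient] <;> ring

end Orientation

section Area

theorem volume_setOf_nonneg_add_le_one :
    volume {z : Plane | 0 ≤ z 0 ∧ 0 ≤ z 1 ∧ z 0 + z 1 ≤ 1} = ENNReal.ofReal (1 / 2) := by
  let S : Set (ℝ × ℝ) := {q | q.1 ∈ Set.Icc (0 : ℝ) 1 ∧ q.2 ∈ Set.Icc (0 : ℝ) (1 - q.1)}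
  have hS : MeasurableSet S :=
    measurableSet_region_between_cc measurable_const (by fun_prop) measurableSet_Icc
  have hpre : {z : Plane | 0 ≤ z 0 ∧ 0 ≤ z 1 ∧ z 0 + z 1 ≤ 1} =
      (fun z : Plane => (z 0, z 1)) ⁻¹' S := by
    ext z
    exact ⟨fun ⟨h0, h1, h2⟩ => ⟨⟨h0, by linarith⟩, h1, by linarith⟩,
      fun ⟨⟨h0, _⟩, h1, h2⟩ => ⟨h0, h1, by linarith⟩⟩
  have hslice : ∀ x : ℝ, volume (Prod.mk x ⁻¹' S) =
      (Set.Icc (0 : ℝ) 1).indicator (fun x => ENNReal.ofReal (1 - x)) x := by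
    intro x
    by_cases hx : x ∈ Set.Icc (0 : ℝ) 1
    · have : Prod.mk x ⁻¹' S = Set.Icc 0 (1 - x) := Set.ext fun y => and_iff_right hx
      rw [Set.indicator_of_mem hx, this, Real.volume_Icc, sub_zero]
    · have : Prod.mk x ⁻¹' S = ∅ := Set.eq_empty_of_forall_notMem fun y hy => hx hy.1
      rw [Set.indicator_of_notMem hx, this, measure_empty]
  have hcoords : MeasurePreserving (fun z : Plane => (z 0, z 1)) volume volume :=
    (volume_preserving_finTwoArrow ℝ).comp (PiLp.volume_preserving_ofLp (Fin 2))
  calc _ = ∫⁻ x, volume (Prod.mk x ⁻¹' S) := by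
        rw [hpre, hcoords.measure_preimage hS.nullMeasurableSet, Measure.volume_eq_prod,
          Measure.prod_apply hS]
    _ = ∫⁻ x in Set.Icc 0 1, ENNReal.ofReal (1 - x) := by
        simp_rw [hslice]
        rw [lintegral_indicator measurableSet_Icc]
    _ = ENNReal.ofReal (∫ x in (0 : ℝ)..1, 1 - x) := by
        rw [intervalIntegral.integral_of_le zero_le_one, ← integral_Icc_eq_integral_Ioc,
          ofReal_integral_eq_lintegral_ofReal]
        · exact (continuous_const.sub continuous_id).integrableOn_Icc
        · filter_upwards [ae_restrict_mem measurableSet_Icc] with x hx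
          exact sub_nonneg.2 hx.2
    _ = ENNReal.ofReal (1 / 2) := by
        rw [intervalIntegral.integral_sub (by simp) (by simp)]
        norm_num

theorem volume_convexHull_triangle_standard :
    volume (convexHull ℝ (Set.range ![(0 : Plane), !₂[1, 0], !₂[0, 1]])) =
      ENNReal.ofReal (1 / 2) := by
  have hset : convexHull ℝ (Set.range ![(0 : Plane), !₂[1, 0], !₂[0, 1]]) =
      {z : Plane | 0 ≤ z 0 ∧ 0 ≤ z 1 ∧ z 0 + z 1 ≤ 1} := by
    refine (convexHull_min ?_ ?_).antisymm fun z ⟨h0, h1, h2⟩ => ?_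
    · rintro _ ⟨i, rfl⟩
      fin_cases i <;> simp
    · intro x ⟨hx0, hx1, hx2⟩ y ⟨hy0, hy1, hy2⟩ a b ha hb hab
      simp only [Set.mem_ofPred_eq, PiLp.add_apply, PiLp.smul_apply, smul_eq_mul]
      exact ⟨by positivity, by positivity, by nlinarith⟩
    · apply mem_convexHull_of_orient_div_nonneg <;> simp [orient] <;> linarith
  rw [hset, volume_setOf_nonneg_add_le_one]

/-- The linear map sending the standard basis of the plane to `u`, `v`. -/
noncomputable def planeMap (u v : Plane) : Plane →ₗ[ℝ] Plane :=
  Matrix.toLpLin 2 2 !![u 0, v 0; u 1, v 1]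

theorem planeMap_apply (u v z : Plane) : planeMap u v z = z 0 • u + z 1 • v := by
  apply plane_ext <;> simp [planeMap, Matrix.toLpLin_apply, Matrix.vecHead, Matrix.vecTail] <;> ring

theorem det_planeMap (u v : Plane) : LinearMap.det (planeMap u v) = orient 0 u v := by
  rw [planeMap, Matrix.toLpLin_eq_toLin, LinearMap.det_toLin, Matrix.det_fin_two_of]
  simp only [orient, PiLp.zero_apply, sub_zero]
  ring

theorem volume_convexHull_triangle (p : Fin 3 → Plane) :
    volume (convexHull ℝ (Set.range p)) = ENNReal.ofReal (|orient (p 0) (p 1) (p 2)| / 2) := by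
  let L := planeMap (p 1 - p 0) (p 2 - p 0)
  let q : Fin 3 → Plane := ![0, !₂[1, 0], !₂[0, 1]]
  have hrange : Set.range p = (p 0 + ·) '' (L '' Set.range q) := by
    rw [← Set.range_comp, ← Set.range_comp]
    congr 1
    funext i
    fin_cases i <;> simp [L, q, planeMap_apply]
  have himage : convexHull ℝ (Set.range p) = (p 0 + ·) '' (L '' convexHull ℝ (Set.range q)) := by
    rw [hrange, L.image_convexHull]
    exact convexHull_vadd (p 0) _
  have hdet : LinearMap.det L = orient (p 0) (p 1) (p 2) := by
    rw [det_planeMap]; simp [orient]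
  rw [himage, Set.image_add_left, measure_preimage_add, Measure.addHaar_image_linearMap, hdet,
    volume_convexHull_triangle_standard, ← ENNReal.ofReal_mul (abs_nonneg _), mul_one_div]

end Area

section Normality

theorem dist_le_perimeter {X : Type*} [PseudoMetricSpace X] (p : Fin 3 → X) (i j : Fin 3) :
    dist (p i) (p j) ≤ dist (p 0) (p 1) + dist (p 1) (p 2) + dist (p 2) (p 0) := by
  fin_cases i <;> fin_cases j <;> dsimp <;>
    linarith [dist_nonneg (x := p 0) (y := p 1), dist_nonneg (x := p 1) (y := p 2),
      dist_nonneg (x := p 2) (y := p 0), dist_comm (p 0) (p 1), dist_comm (p 1) (p 2),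
      dist_comm (p 2) (p 0), dist_self (p 0), dist_self (p 1), dist_self (p 2)]

theorem IsTriangle.exists_hasPerimeter_le {T : Set Plane} {y : Plane} {R : ℝ}
    (hT : IsTriangle T) (hTR : T ⊆ Metric.closedBall y R) :
    ∃ p, HasPerimeter T p ∧ p ≤ 6 * R := by
  obtain ⟨t, ht⟩ := hT
  have hy : ∀ i, dist (t.points i) y ≤ R := fun i =>
    hTR (ht ▸ subset_convexHull ℝ _ (Set.mem_range_self i))
  have hside : ∀ i j, dist (t.points i) (t.points j) ≤ 2 * R := fun i j => by
    linarith [dist_triangle_right (t.points i) (t.points j) y, hy i, hy j]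
  exact ⟨_, ⟨t, ht, rfl⟩, by linarith [hside 0 1, hside 1 2, hside 2 0]⟩

theorem HasPerimeter.exists_closedBall_subset_and_subset {T : Set Plane} {p R a : ℝ}
    (hp : HasPerimeter T p) (hpR : p ≤ R) (ha : 0 < a) (hT : ENNReal.ofReal a ≤ volume T) :
    (∃ x, Metric.closedBall x (2 * a / (3 * R)) ⊆ T) ∧ ∃ y, T ⊆ Metric.closedBall y R := by
  obtain ⟨t, rfl, rfl⟩ := hp
  have hside : ∀ i j, dist (t.points i) (t.points j) ≤ R := fun i j =>
    (dist_le_perimeter t.points i j).trans hpR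
  have hR : 0 ≤ R := dist_nonneg.trans (hside 0 1)
  set D := orient (t.points 0) (t.points 1) (t.points 2)
  have hD : 2 * a ≤ |D| := by
    rw [volume_convexHull_triangle, ENNReal.ofReal_le_ofReal_iff (by positivity)] at hT
    linarith
  refine ⟨⟨_, (Metric.closedBall_subset_closedBall ?_).trans
    (closedBall_centroid_subset_convexHull (abs_pos.1 (by linarith)) hside)⟩, t.points 0, ?_⟩
  · gcongr
  · refine convexHull_min ?_ (convex_closedBall _ _)
    rintro _ ⟨i, rfl⟩
    exact hside i 0

theorem isNormal_iff_exists_perimeter_le {𝒯 : Set (Set Plane)} {a : ℝ} (ha : 0 < a)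
    (h𝒯 : ∀ T ∈ 𝒯, IsTriangle T ∧ ENNReal.ofReal a ≤ volume T) :
    IsNormal 𝒯 ↔ ∃ c : ℝ, ∀ T ∈ 𝒯, ∃ p : ℝ, HasPerimeter T p ∧ p ≤ c := by
  constructor
  · rintro ⟨r, R, -, -, hR⟩
    refine ⟨6 * R, fun T hT => ?_⟩
    obtain ⟨-, y, hy⟩ := hR T hT
    exact IsTriangle.exists_hasPerimeter_le (h𝒯 T hT).1 hy
  · rintro ⟨c, hc⟩
    let R := max (max c 1) (2 * a)
    have h1R : 1 ≤ R := (le_max_right c 1).trans (le_max_left _ _)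
    refine ⟨2 * a / (3 * R), R, by positivity, ?_, fun T hT => ?_⟩
    · rw [div_lt_iff₀ (by positivity)]
      nlinarith [le_max_right (max c 1) (2 * a)]
    · obtain ⟨p, hp, hpc⟩ := hc T hT
      exact hp.exists_closedBall_subset_and_subset
        (hpc.trans ((le_max_left c 1).trans (le_max_left _ _))) ha (h𝒯 T hT).2

end Normality

section Separation

variable {ι : Type*}

/-- Two families of points are separated if some line has the first family on its left and the
second on its right, where either may touch the line. -/
def Separated (p q : ι → Plane) : Prop :=
  ∃ a b, a ≠ b ∧ (∀ i, 0 ≤ orient a b (p i)) ∧ ∀ i, orient a b (q i) ≤ 0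

theorem Separated.symm {p q : ι → Plane} (h : Separated p q) : Separated q p := by
  obtain ⟨a, b, hab, hp, hq⟩ := h
  exact ⟨b, a, hab.symm, fun i => by simpa [orient_swap_left a b] using hq i,
    fun i => by simpa [orient_swap_left a b] using hp i⟩

theorem exists_strongDual_orient {a b : Plane} (hab : a ≠ b) :
    ∃ f : StrongDual ℝ Plane, f ≠ 0 ∧ ∀ z, orient a b z = f z - f a := by
  let f : StrongDual ℝ Plane :=
    (b 0 - a 0) • EuclideanSpace.proj 1 - (b 1 - a 1) • EuclideanSpace.proj 0
  refine ⟨f, fun hf => hab ?_, fun z => ?_⟩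
  · have h0 : f (EuclideanSpace.single 0 1) = a 1 - b 1 := by simp [f]
    have h1 : f (EuclideanSpace.single 1 1) = b 0 - a 0 := by simp [f]
    rw [hf, zero_apply] at h0 h1
    exact plane_ext (by linarith) (by linarith)
  · simp [f, orient]; ring

theorem Separated.disjoint_interior {p q : ι → Plane} (h : Separated p q) :
    Disjoint (interior (convexHull ℝ (Set.range p))) (interior (convexHull ℝ (Set.range q))) := by
  obtain ⟨a, b, hab, hp, hq⟩ := h
  obtain ⟨f, hf, hfab⟩ := exists_strongDual_orient hab
  refine disjoint_interior_convexHull_of_le_of_le hf (c := f a) ?_ ?_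
  · rintro _ ⟨i, rfl⟩
    linarith [hp i, hfab (p i)]
  · rintro _ ⟨i, rfl⟩
    linarith [hq i, hfab (q i)]

theorem isUnitTriangleTiling_range {κ : Type*} [Countable κ] {p : κ → Fin 3 → Plane}
    (harea : ∀ a, |orient (p a 0) (p a 1) (p a 2)| = 2)
    (hsep : Pairwise fun a b => Separated (p a) (p b))
    (hcover : ∀ z, ∃ a, z ∈ convexHull ℝ (Set.range (p a))) :
    IsUnitTriangleTiling (Set.range fun a => convexHull ℝ (Set.range (p a))) := by
  refine ⟨⟨Set.countable_range _, ?_, ?_, ?_⟩, ?_⟩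
  · rintro _ ⟨a, rfl⟩
    exact (Set.finite_range _).isCompact_convexHull (𝕜 := ℝ)
  · rintro _ ⟨a, rfl⟩ _ ⟨b, rfl⟩ hne
    exact (hsep (ne_of_apply_ne (fun a => convexHull ℝ (Set.range (p a))) hne)).disjoint_interior
  · simpa [Set.eq_univ_iff_forall] using hcover
  · rintro _ ⟨a, rfl⟩
    have hne : orient (p a 0) (p a 1) (p a 2) ≠ 0 := abs_ne_zero.1 (by rw [harea]; norm_num)
    exact ⟨⟨⟨p a, affineIndependent_of_orient_ne_zero hne⟩, rfl⟩, by
      rw [volume_convexHull_triangle, harea]; norm_num⟩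

end Separation

section Shears

variable {ι : Type*}

/-- The horizontal shear with slope `μ` followed by the translation by `t`. -/
noncomputable def shear (μ : ℝ) (t : Plane) : Plane ≃ᵃ[ℝ] Plane :=
  (LinearEquiv.transvection (f := (EuclideanSpace.projₗ 1 : Plane →ₗ[ℝ] ℝ))
    (v := EuclideanSpace.single 0 μ) (by simp)).toAffineEquiv.trans
      (AffineEquiv.constVAdd ℝ Plane t)

@[simp] theorem shear_apply_zero (μ : ℝ) (t z : Plane) :
    shear μ t z 0 = z 0 + μ * z 1 + t 0 := by
  simp [shear, LinearMap.transvection.apply]; ring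

@[simp] theorem shear_apply_one (μ : ℝ) (t z : Plane) : shear μ t z 1 = z 1 + t 1 := by
  simp [shear, LinearMap.transvection.apply]; ring

@[simp] theorem orient_shear (μ : ℝ) (t a b c : Plane) :
    orient (shear μ t a) (shear μ t b) (shear μ t c) = orient a b c := by
  simp only [orient, shear_apply_zero, shear_apply_one]; ring

theorem shear_mem_convexHull {p : ι → Plane} {z : Plane} (μ : ℝ) (t : Plane)
    (hz : z ∈ convexHull ℝ (Set.range p)) :
    shear μ t z ∈ convexHull ℝ (Set.range (shear μ t ∘ p)) := by
  rw [Set.range_comp, ← AffineEquiv.coe_toAffineMap, ← AffineMap.image_convexHull]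
  exact Set.mem_image_of_mem _ hz

theorem Separated.shear_comp {p q : ι → Plane} (h : Separated p q) (μ : ℝ) (t : Plane) :
    Separated (shear μ t ∘ p) (shear μ t ∘ q) := by
  obtain ⟨a, b, hab, hp, hq⟩ := h
  exact ⟨shear μ t a, shear μ t b, (shear μ t).injective.ne hab, by simpa, by simpa⟩

variable [Fintype ι]

/-- The sum of the squared vertical distances over all ordered pairs of members of a finite
family. -/
noncomputable def verticalMoment (p : ι → Plane) : ℝ := ∑ i, ∑ j, (p i 1 - p j 1) ^ 2

/-- The sum of the products of horizontal and vertical differences over all ordered pairs of members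
of a finite family. -/
noncomputable def mixedMoment (p : ι → Plane) : ℝ :=
  ∑ i, ∑ j, (p i 0 - p j 0) * (p i 1 - p j 1)

theorem verticalMoment_shear (μ : ℝ) (t : Plane) (p : ι → Plane) :
    verticalMoment (shear μ t ∘ p) = verticalMoment p := by
  simp [verticalMoment]

theorem mixedMoment_shear (μ : ℝ) (t : Plane) (p : ι → Plane) :
    mixedMoment (shear μ t ∘ p) = mixedMoment p + μ * verticalMoment p := by
  simp only [mixedMoment, verticalMoment, Finset.mul_sum, ← Finset.sum_add_distrib,
    Function.comp_apply, shear_apply_zero, shear_apply_one]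
  refine Finset.sum_congr rfl fun i _ => Finset.sum_congr rfl fun j _ => ?_
  ring

theorem sumSqDist_shear (μ : ℝ) (t : Plane) (p : ι → Plane) :
    sumSqDist (shear μ t ∘ p) =
      sumSqDist p + 2 * μ * mixedMoment p + μ ^ 2 * verticalMoment p := by
  simp only [sumSqDist, mixedMoment, verticalMoment, Finset.mul_sum, ← Finset.sum_add_distrib,
    Function.comp_apply, dist_sq_eq, shear_apply_zero, shear_apply_one]
  refine Finset.sum_congr rfl fun i _ => Finset.sum_congr rfl fun j _ => ?_
  ring

theorem finite_setOf_quadratic_eq_zero {R : Type*} [CommRing R] [IsDomain R] {a b c : R}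
    (h : ¬(a = 0 ∧ b = 0)) : {x | a * x ^ 2 + b * x + c = 0}.Finite := by
  open Polynomial in
  have hP : C a * X ^ 2 + C b * X + C c ≠ 0 := fun h0 => h
    ⟨by simpa using congrArg (coeff · 2) h0, by simpa using congrArg (coeff · 1) h0⟩
  exact (Polynomial.finite_setOfPred_isRoot hP).subset fun x hx => by
    simpa [Polynomial.IsRoot] using hx

theorem exists_shear_injective_sumSqDist {κ : Type*} [Countable κ] {p : κ → ι → Plane}
    (hp : Function.Injective fun k => (verticalMoment (p k), mixedMoment (p k))) {a b : ℝ}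
    (hab : a < b) :
    ∃ μ ∈ Set.Ioo a b, Function.Injective fun k => sumSqDist (shear μ 0 ∘ p k) := by
  let collisions (k l : κ) : Set ℝ :=
    {μ | sumSqDist (shear μ 0 ∘ p k) = sumSqDist (shear μ 0 ∘ p l)}
  have hcollisions : ∀ k l, k ≠ l → (collisions k l).Countable := by
    intro k l hkl
    have hne : ¬(verticalMoment (p k) - verticalMoment (p l) = 0 ∧
        2 * (mixedMoment (p k) - mixedMoment (p l)) = 0) := fun h =>
      hkl (hp (Prod.ext (by linarith [h.1]) (by linarith [h.2])))
    refine ((finite_setOf_quadratic_eq_zero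
      (c := sumSqDist (p k) - sumSqDist (p l)) hne).subset fun μ hμ => ?_).countable
    simp only [collisions, Set.mem_ofPred_eq, sumSqDist_shear] at hμ ⊢
    linear_combination hμ
  have hbad : (⋃ k, ⋃ l, ⋃ _ : k ≠ l, collisions k l).Countable :=
    Set.countable_iUnion fun k => Set.countable_iUnion fun l => Set.countable_iUnion
      (hcollisions k l)
  obtain ⟨μ, hμ, hμab⟩ := (hbad.dense_compl ℝ).exists_between hab
  refine ⟨μ, hμab, fun k l hkl => by_contra fun hne => hμ ?_⟩
  simp only [Set.mem_iUnion]
  exact ⟨k, l, hne, hkl⟩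

end Shears

section Fans

variable {n : ℕ} {O : Plane} {v : Fin (n + 1) → Plane}

/-- The triangles spanned by an apex and two consecutive points of a polygonal path. -/
def fanTriangle (O : Plane) (v : Fin (n + 1) → Plane) (k : Fin n) : Fin 3 → Plane :=
  ![O, v k.castSucc, v k.succ]

/-- A path turns counterclockwise around a point, strictly at each step and by at most a straight
angle in total. -/
structure IsFan (O : Plane) (v : Fin (n + 1) → Plane) : Prop where
  nonneg : ∀ i k, i ≤ k → 0 ≤ orient O (v i) (v k)
  pos : ∀ k : Fin n, 0 < orient O (v k.castSucc) (v k.succ)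

theorem IsFan.separated_of_lt (h : IsFan O v) {i k : Fin n} (hik : i < k) :
    Separated (fanTriangle O v k) (fanTriangle O v i) := by
  refine ⟨O, v k.castSucc, fun hO => (h.pos k).ne' (by rw [← hO, orient_self_left]), ?_, ?_⟩
  · simpa [fanTriangle, Fin.forall_fin_succ] using (h.pos k).le
  · have hi : i.succ ≤ k.castSucc := hik
    have hi' : i.castSucc ≤ k.castSucc := hik.le
    simp [fanTriangle, Fin.forall_fin_succ, orient_swap_right O (v i.castSucc),
      orient_swap_right O (v i.succ), h.nonneg _ _ hi, h.nonneg _ _ hi']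

theorem IsFan.pairwise_separated (h : IsFan O v) :
    Pairwise fun i k => Separated (fanTriangle O v i) (fanTriangle O v k) := fun _ _ hik =>
  hik.lt_or_gt.elim (fun hlt => (h.separated_of_lt hlt).symm) h.separated_of_lt

theorem exists_castSucc_nonneg_succ_nonpos {R : Type*} [LinearOrder R] [Zero R] (hn : n ≠ 0)
    {f : Fin (n + 1) → R} (h0 : 0 ≤ f 0) (hlast : f (Fin.last n) ≤ 0) :
    ∃ k : Fin n, 0 ≤ f k.castSucc ∧ f k.succ ≤ 0 := by
  by_contra! hf
  have hpos : ∀ k, 0 ≤ f k := Fin.induction h0 fun k hk => (hf k hk).le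
  obtain ⟨m, rfl⟩ := Nat.exists_eq_succ_of_ne_zero hn
  exact (hf (Fin.last m) (hpos _)).not_ge hlast

theorem IsFan.exists_mem (h : IsFan O v) (hn : n ≠ 0) {z : Plane} (h0 : 0 ≤ orient O (v 0) z)
    (hlast : orient O (v (Fin.last n)) z ≤ 0)
    (hside : ∀ k : Fin n, 0 ≤ orient (v k.castSucc) (v k.succ) z) :
    ∃ k, z ∈ convexHull ℝ (Set.range (fanTriangle O v k)) := by
  obtain ⟨k, hk, hk'⟩ :=
    exists_castSucc_nonneg_succ_nonpos (f := fun k => orient O (v k) z) hn h0 hlast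
  have hk'' : 0 ≤ orient (v k.succ) O z := by rw [orient_swap_left]; linarith
  exact ⟨k, mem_convexHull_of_orient_div_nonneg (h.pos k).ne' (div_nonneg (hside k) (h.pos k).le)
    (div_nonneg hk'' (h.pos k).le) (div_nonneg hk (h.pos k).le)⟩

end Fans

section Block

theorem sqrt_five_sq : √5 ^ 2 = 5 := Real.sq_sqrt (by norm_num)

theorem two_lt_sqrt_five : 2 < √5 := Real.lt_sqrt_of_sq_lt (by norm_num)

theorem sqrt_five_lt_three : √5 < 3 := (Real.sqrt_lt' (by norm_num)).2 (by norm_num)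

/-- The common apex of the five triangles dissecting the left part of a block, the trapezoid with
vertices `(0, 0)`, `(5 - √5, 0)`, `(5 + √5, 1)`, `(0, 1)`. -/
noncomputable def leftApex : Plane := !₂[0, (5 + √5) / 10]

/-- The boundary of the trapezoid, cut at points that make its five fan triangles equal in area. -/
noncomputable def leftRim : Fin (5 + 1) → Plane :=
  ![!₂[0, 0], !₂[5 - √5, 0], !₂[5 - √5 / 3, 1 / 3], !₂[5 + √5 / 3, 2 / 3], !₂[5 + √5, 1], !₂[0, 1]]

/-- The common apex of the triangles dissecting the right part of a block. -/
noncomputable def rightApex : Plane := !₂[5 + √5, 1]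

/-- The equally spaced feet of the triangles dissecting the right part of a block. -/
noncomputable def rightFeet (n : ℕ) (m : Fin (n + 1)) : Plane := !₂[5 - √5 + 2 * m, 0]

/-- The triangles dissecting a block: five in its left part and `n` in its right part. -/
noncomputable def prototile (n : ℕ) : Fin 5 ⊕ Fin n → Fin 3 → Plane :=
  Sum.elim (fanTriangle leftApex leftRim) (fanTriangle rightApex (rightFeet n))

/-- The width at height `t` of a block with `n` triangles in its right part. -/
noncomputable def width (n : ℕ) (t : ℝ) : ℝ := (1 - t) * (5 - √5 + 2 * n) + t * (5 + √5)

/-- The trapezoid of height `1` with a vertical left side and horizontal sides of lengths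
`width n 0` and `width n 1`. -/
def block (n : ℕ) : Set Plane := {w | 0 ≤ w 0 ∧ 0 ≤ w 1 ∧ w 1 ≤ 1 ∧ w 0 ≤ width n (w 1)}

theorem orient_leftFan (k : Fin 5) :
    orient leftApex (leftRim k.castSucc) (leftRim k.succ) = 2 := by
  fin_cases k <;> simp [leftApex, leftRim, orient] <;> linarith [sqrt_five_sq]

theorem isFan_left : IsFan leftApex leftRim where
  nonneg i k hik := by
    have h2 := two_lt_sqrt_five
    have h3 := sqrt_five_lt_three
    fin_cases i <;> fin_cases k <;> first
      | exact absurd hik (by decide)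
      | (simp [leftApex, leftRim, orient] <;> linarith [sqrt_five_sq])
  pos k := by rw [orient_leftFan]; norm_num

theorem orient_rightFeet (n : ℕ) (i k : Fin (n + 1)) :
    orient rightApex (rightFeet n i) (rightFeet n k) = 2 * (k - i) := by
  simp [orient, rightApex, rightFeet]; ring

theorem isFan_right (n : ℕ) : IsFan rightApex (rightFeet n) where
  nonneg i k hik := by
    have : (i : ℝ) ≤ k := mod_cast hik
    rw [orient_rightFeet]
    linarith
  pos k := by rw [orient_rightFeet]; simp

theorem orient_prototile (n : ℕ) (i : Fin 5 ⊕ Fin n) :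
    orient (prototile n i 0) (prototile n i 1) (prototile n i 2) = 2 := by
  rcases i with k | k
  · exact orient_leftFan k
  · exact (orient_rightFeet n _ _).trans (by simp)

theorem fanTriangle_mem {n : ℕ} {O : Plane} {v : Fin (n + 1) → Plane} {S : Set Plane} (hO : O ∈ S)
    (hv : ∀ m, v m ∈ S) (k : Fin n) (i : Fin 3) : fanTriangle O v k i ∈ S := by
  fin_cases i
  exacts [hO, hv _, hv _]

theorem prototile_mem_block (n : ℕ) (i : Fin 5 ⊕ Fin n) (k : Fin 3) :
    prototile n i k ∈ block n := by
  have h2 := two_lt_sqrt_five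
  have h3 := sqrt_five_lt_three
  rcases i with i | i
  · refine fanTriangle_mem ?_ (fun m => ?_) i k
    · refine ⟨?_, ?_, ?_, ?_⟩ <;> simp [leftApex, width] <;> nlinarith [sqrt_five_sq]
    · fin_cases m <;> refine ⟨?_, ?_, ?_, ?_⟩ <;> simp [leftRim, width] <;> linarith
  · refine fanTriangle_mem ?_ (fun m => ?_) i k
    · refine ⟨?_, ?_, ?_, ?_⟩ <;> simp [rightApex, width]; linarith
    · have hm : (m : ℝ) ≤ n := mod_cast m.is_le
      refine ⟨?_, ?_, ?_, ?_⟩ <;> simp [rightFeet, width, hm]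
      linarith [(m : ℕ).cast_nonneg (α := ℝ)]

theorem orient_diagonal (w : Plane) :
    orient !₂[5 - √5, 0] rightApex w = 2 * √5 * w 1 - (w 0 - (5 - √5)) := by
  simp only [orient, rightApex, PiLp.toLp_apply, Matrix.cons_val]; ring

theorem separated_left_right {n : ℕ} (i : Fin 5) (k : Fin n) :
    Separated (prototile n (.inl i)) (prototile n (.inr k)) := by
  have h2 := two_lt_sqrt_five
  have h3 := sqrt_five_lt_three
  refine ⟨!₂[5 - √5, 0], rightApex, ?_, fanTriangle_mem (S := {w | 0 ≤ orient _ _ w}) ?_ ?_ i,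
    fanTriangle_mem (S := {w | orient _ _ w ≤ 0}) ?_ ?_ k⟩
  · exact fun h => by simpa [rightApex] using congrArg (· 1) h
  · simp [orient_diagonal, leftApex]; linarith [sqrt_five_sq]
  · intro m
    fin_cases m <;> simp [orient_diagonal, leftRim] <;> linarith
  · simp
  · simp [orient_diagonal, rightFeet]

theorem pairwise_separated_prototile (n : ℕ) :
    Pairwise fun i k => Separated (prototile n i) (prototile n k) := by
  rintro (i | i) (k | k) hik
  · exact isFan_left.pairwise_separated fun h => hik (congrArg _ h)
  · exact separated_left_right i k
  · exact (separated_left_right k i).symm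
  · exact (isFan_right n).pairwise_separated fun h => hik (congrArg _ h)

theorem exists_mem_left {n : ℕ} {w : Plane} (hw : w ∈ block n)
    (hdiag : 0 ≤ orient !₂[5 - √5, 0] rightApex w) :
    ∃ k, w ∈ convexHull ℝ (Set.range (fanTriangle leftApex leftRim k)) := by
  obtain ⟨h0, h1, h1', -⟩ := hw
  have h2 := two_lt_sqrt_five
  have h3 := sqrt_five_lt_three
  rw [orient_diagonal] at hdiag
  refine isFan_left.exists_mem (by norm_num) ?_ ?_ fun k => ?_
  · suffices 0 ≤ (5 + √5) / 10 * w 0 by simpa [orient, leftApex, leftRim]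
    positivity
  · simp [orient, leftApex, leftRim]; nlinarith
  · fin_cases k <;> simp [orient, leftRim] <;> nlinarith

theorem exists_mem_right {n : ℕ} (hn : n ≠ 0) {w : Plane} (hw : w ∈ block n)
    (hdiag : orient !₂[5 - √5, 0] rightApex w ≤ 0) :
    ∃ k, w ∈ convexHull ℝ (Set.range (fanTriangle rightApex (rightFeet n) k)) := by
  obtain ⟨-, h1, -, hwidth⟩ := hw
  rw [orient_diagonal] at hdiag
  rw [width] at hwidth
  refine (isFan_right n).exists_mem hn ?_ ?_ fun k => ?_
  · simp [orient, rightApex, rightFeet]; linarith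
  · simp [orient, rightApex, rightFeet]; linarith
  · simp [orient, rightFeet]; linarith

theorem exists_mem_prototile {n : ℕ} (hn : n ≠ 0) {w : Plane} (hw : w ∈ block n) :
    ∃ i, w ∈ convexHull ℝ (Set.range (prototile n i)) := by
  rcases le_total 0 (orient !₂[5 - √5, 0] rightApex w) with hdiag | hdiag
  · obtain ⟨k, hk⟩ := exists_mem_left hw hdiag
    exact ⟨.inl k, hk⟩
  · obtain ⟨k, hk⟩ := exists_mem_right hn hw hdiag
    exact ⟨.inr k, hk⟩

end Block

section Rows

/-- The fractional parts of an arithmetic progression with difference `√5`; they control the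
position of the upper side of a block relative to its lower side. -/
noncomputable def offset (s : ℝ) (p : ℤ) : ℝ := Int.fract (s + p * √5)

/-- The number of triangles in the right part of a block. This is the carry that keeps the offset in
`[0, 1)` when passing to the next block. -/
noncomputable def fanSize (s : ℝ) (p : ℤ) : ℕ := (⌊s + (p + 1) * √5⌋ - ⌊s + p * √5⌋).toNat

theorem offset_nonneg (s : ℝ) (p : ℤ) : 0 ≤ offset s p := Int.fract_nonneg _

theorem offset_lt_one (s : ℝ) (p : ℤ) : offset s p < 1 := Int.fract_lt_one _

theorem offset_succ (s : ℝ) (p : ℤ) : offset s (p + 1) = offset s p + √5 - fanSize s p := by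
  have hle : ⌊s + p * √5⌋ ≤ ⌊s + (p + 1) * √5⌋ := Int.floor_mono (by linarith [Real.sqrt_nonneg 5])
  have hcast : (fanSize s p : ℝ) = ⌊s + (p + 1) * √5⌋ - ⌊s + p * √5⌋ := by
    rw [fanSize, ← Int.cast_natCast, Int.toNat_of_nonneg (sub_nonneg.2 hle), Int.cast_sub]
  rw [hcast, offset, offset, Int.fract, Int.fract]
  push_cast
  ring

theorem fanSize_ne_zero (s : ℝ) (p : ℤ) : fanSize s p ≠ 0 := by
  intro h
  have hsucc := offset_succ s p
  rw [h, Nat.cast_zero] at hsucc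
  linarith [offset_nonneg s p, offset_lt_one s (p + 1), two_lt_sqrt_five]

theorem width_fanSize_lt (s : ℝ) (p : ℤ) {t : ℝ} (h0 : 0 ≤ t) (h1 : t ≤ 1) :
    width (fanSize s p) t < 10 := by
  have h3 := sqrt_five_lt_three
  have hn : 5 - √5 + 2 * fanSize s p < 10 := by
    linarith [offset_succ s p, offset_lt_one s p, offset_nonneg s (p + 1)]
  rw [width]
  nlinarith

theorem width_nonneg (n : ℕ) {t : ℝ} (h0 : 0 ≤ t) (h1 : t ≤ 1) : 0 ≤ width n t := by
  have h3 := sqrt_five_lt_three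
  exact add_nonneg (mul_nonneg (by linarith) (by linarith [n.cast_nonneg (α := ℝ)]))
    (mul_nonneg h0 (by positivity))

/-- The abscissa of the left side of a block of a row, at height `t` above the bottom of the row. -/
noncomputable def leftSide (s : ℝ) (p : ℤ) (t : ℝ) : ℝ := (5 + √5) * p - 2 * offset s p * (1 - t)

theorem leftSide_succ (s : ℝ) (p : ℤ) (t : ℝ) :
    leftSide s (p + 1) t = leftSide s p t + width (fanSize s p) t := by
  rw [leftSide, leftSide, width, offset_succ]
  push_cast
  ring

theorem leftSide_mono (s : ℝ) {t : ℝ} (h0 : 0 ≤ t) (h1 : t ≤ 1) :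
    Monotone fun p => leftSide s p t :=
  monotone_int_of_le_succ fun p => by
    rw [leftSide_succ]
    exact le_add_of_nonneg_right (width_nonneg _ h0 h1)

theorem exists_leftSide_le_le (s x : ℝ) {t : ℝ} (h0 : 0 ≤ t) (h1 : t ≤ 1) :
    ∃ p, leftSide s p t ≤ x ∧ x ≤ leftSide s (p + 1) t := by
  have hpos : 0 < 5 + √5 := by positivity
  have hoff : ∀ p, 0 ≤ offset s p * (1 - t) ∧ offset s p * (1 - t) ≤ 1 := fun p =>
    ⟨mul_nonneg (offset_nonneg s p) (by linarith),
      mul_le_one₀ (offset_lt_one s p).le (by linarith) (by linarith)⟩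
  obtain ⟨p, hp, hmax⟩ := Int.exists_greatest_of_bdd (P := fun p => leftSide s p t ≤ x)
    ⟨⌊(x + 2) / (5 + √5)⌋, fun p hp => Int.le_floor.2 <| (le_div_iff₀' hpos).2 <| by
      rw [leftSide] at hp; linarith [hoff p]⟩
    ⟨⌊x / (5 + √5)⌋, by
      have := (le_div_iff₀' hpos).1 (Int.floor_le (x / (5 + √5)))
      rw [leftSide]; linarith [hoff ⌊x / (5 + √5)⌋]⟩
  exact ⟨p, hp, (not_le.1 fun h => absurd (hmax _ h) (by simp)).le⟩

/-- The phase of a row: pairwise distinct rational numbers between `0` and `1`. -/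
noncomputable def rowShift (j : ℤ) : ℝ := ((Encodable.encode j : ℝ) + 2)⁻¹

theorem rowShift_mem_Ioo (j : ℤ) : rowShift j ∈ Set.Ioo 0 1 :=
  ⟨by unfold rowShift; positivity,
    inv_lt_one_of_one_lt₀ (by linarith [(Encodable.encode j).cast_nonneg (α := ℝ)])⟩

theorem rowShift_injective : Function.Injective rowShift := fun _ _ h =>
  Encodable.encode_injective (Nat.cast_injective (add_right_cancel (inv_injective h)))

theorem eq_of_offset_rowShift_eq {j p j' p' : ℤ}
    (h : offset (rowShift j) p = offset (rowShift j') p') : j = j' ∧ p = p' := by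
  obtain ⟨m, hm⟩ := Int.fract_eq_fract.1 h
  have hp : p = p' := by
    by_contra hne
    have hirr : Irrational (((p - p' : ℤ) : ℝ) * √5) :=
      (Nat.Prime.irrational_sqrt (p := 5) (by norm_num)).intCast_mul (sub_ne_zero.2 hne)
    refine hirr ⟨m - ((Encodable.encode j : ℚ) + 2)⁻¹ + ((Encodable.encode j' : ℚ) + 2)⁻¹, ?_⟩
    rw [rowShift, rowShift] at hm
    push_cast
    linarith
  subst hp
  obtain ⟨hj, hj'⟩ := rowShift_mem_Ioo j
  obtain ⟨hk, hk'⟩ := rowShift_mem_Ioo j'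
  have hm1 : m < 1 := by exact_mod_cast (by linarith : (m : ℝ) < 1)
  have hm2 : -1 < m := by exact_mod_cast (by linarith : (-1 : ℝ) < m)
  obtain rfl : m = 0 := by lia
  exact ⟨rowShift_injective (by push_cast at hm; linarith), rfl⟩

/-- The copy of a block in position `p` of row `j`. -/
def cell (j p : ℤ) : Set Plane :=
  {z | z 1 - j ∈ Set.Icc 0 1 ∧
    z 0 ∈ Set.Icc (leftSide (rowShift j) p (z 1 - j)) (leftSide (rowShift j) (p + 1) (z 1 - j))}

/-- The affine bijection from a block to a cell. -/
noncomputable def place (j p : ℤ) : Plane ≃ᵃ[ℝ] Plane :=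
  shear (2 * offset (rowShift j) p) !₂[leftSide (rowShift j) p 0, j]

theorem place_mem_cell_iff {j p : ℤ} {w : Plane} :
    place j p w ∈ cell j p ↔ w ∈ block (fanSize (rowShift j) p) := by
  have hx : place j p w 0 = w 0 + leftSide (rowShift j) p (w 1) := by
    simp [place, leftSide]; ring
  have hy : place j p w 1 - j = w 1 := by simp [place]
  rw [cell, block, Set.mem_ofPred_eq, Set.mem_ofPred_eq, hx, hy, leftSide_succ, Set.mem_Icc,
    Set.mem_Icc, le_add_iff_nonneg_left, add_comm (w 0), add_le_add_iff_left]
  tauto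

theorem exists_mem_cell (z : Plane) : ∃ j p, z ∈ cell j p := by
  have h0 := Int.fract_nonneg (z 1)
  have h1 := (Int.fract_lt_one (z 1)).le
  obtain ⟨p, hp⟩ := exists_leftSide_le_le (rowShift ⌊z 1⌋) (z 0) h0 h1
  exact ⟨⌊z 1⌋, p, ⟨h0, h1⟩, hp⟩

theorem separated_of_mem_cell_of_row_lt {ι : Type*} {q q' : ι → Plane} {j p j' p' : ℤ}
    (hq : ∀ i, q i ∈ cell j p) (hq' : ∀ i, q' i ∈ cell j' p') (hj : j < j') : Separated q' q := by
  have hj' : (j : ℝ) + 1 ≤ j' := mod_cast hj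
  have horient : ∀ z, orient !₂[0, (j' : ℝ)] !₂[1, (j' : ℝ)] z = z 1 - j' := fun z => by
    simp [orient]
  refine ⟨!₂[0, j'], !₂[1, j'], fun h => by simpa using congrArg (· 0) h, fun i => ?_, fun i => ?_⟩
  · rw [horient]
    exact (hq' i).1.1
  · rw [horient]
    linarith [(hq i).1.2]

theorem separated_of_mem_cell_of_position_lt {ι : Type*} {q q' : ι → Plane} {j p p' : ℤ}
    (hq : ∀ i, q i ∈ cell j p) (hq' : ∀ i, q' i ∈ cell j p') (hp : p < p') : Separated q q' := by
  have horient : ∀ z, orient !₂[leftSide (rowShift j) p' 0, (j : ℝ)]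
      !₂[leftSide (rowShift j) p' 1, (j : ℝ) + 1] z = leftSide (rowShift j) p' (z 1 - j) - z 0 :=
    fun z => by simp [orient, leftSide]; ring
  refine ⟨!₂[leftSide (rowShift j) p' 0, j], !₂[leftSide (rowShift j) p' 1, j + 1],
    fun h => by simpa using congrArg (· 1) h, fun i => ?_, fun i => ?_⟩
  · rw [horient]
    obtain ⟨⟨h0, h1⟩, -, hright⟩ := hq i
    exact sub_nonneg.2 (hright.trans (leftSide_mono _ h0 h1 hp))
  · rw [horient]
    exact sub_nonpos.2 (hq' i).2.1

/-- A tile is indexed by the row and the position of its block and by its prototile. -/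
abbrev TileIndex : Type := Σ b : ℤ × ℤ, Fin 5 ⊕ Fin (fanSize (rowShift b.1) b.2)

/-- The vertices of the tiles, before the final shear. -/
noncomputable def vertices (a : TileIndex) : Fin 3 → Plane :=
  place a.1.1 a.1.2 ∘ prototile (fanSize (rowShift a.1.1) a.1.2) a.2

theorem vertices_mem_cell (a : TileIndex) (k : Fin 3) : vertices a k ∈ cell a.1.1 a.1.2 :=
  place_mem_cell_iff.2 (prototile_mem_block _ _ _)

theorem orient_vertices (a : TileIndex) :
    orient (vertices a 0) (vertices a 1) (vertices a 2) = 2 :=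
  (orient_shear _ _ _ _ _).trans (orient_prototile _ _)

theorem pairwise_separated_vertices :
    Pairwise fun a b => Separated (vertices a) (vertices b) := by
  rintro ⟨⟨j, p⟩, i⟩ ⟨⟨j', p'⟩, i'⟩ hne
  rcases lt_trichotomy j j' with hj | rfl | hj
  · exact (separated_of_mem_cell_of_row_lt (vertices_mem_cell _) (vertices_mem_cell _) hj).symm
  · rcases lt_trichotomy p p' with hp | rfl | hp
    · exact separated_of_mem_cell_of_position_lt (j := j) (vertices_mem_cell _)
        (vertices_mem_cell _) hp
    · exact (pairwise_separated_prototile _ fun h => hne (congrArg _ h)).shear_comp _ _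
    · exact (separated_of_mem_cell_of_position_lt (j := j) (vertices_mem_cell _)
        (vertices_mem_cell _) hp).symm
  · exact separated_of_mem_cell_of_row_lt (vertices_mem_cell _) (vertices_mem_cell _) hj

theorem exists_mem_convexHull_vertices (z : Plane) :
    ∃ a, z ∈ convexHull ℝ (Set.range (vertices a)) := by
  obtain ⟨j, p, hz⟩ := exists_mem_cell z
  obtain ⟨w, rfl⟩ := (place j p).surjective z
  obtain ⟨i, hi⟩ := exists_mem_prototile (fanSize_ne_zero _ _) (place_mem_cell_iff.1 hz)
  exact ⟨⟨(j, p), i⟩, shear_mem_convexHull _ _ hi⟩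

theorem isUnitTriangleTiling_range_shear (μ : ℝ) :
    IsUnitTriangleTiling
      (Set.range fun a => convexHull ℝ (Set.range (shear μ 0 ∘ vertices a))) := by
  refine isUnitTriangleTiling_range (fun a => ?_)
    (fun a b hab => (pairwise_separated_vertices hab).shear_comp _ _) fun z => ?_
  · simp [orient_vertices]
  · obtain ⟨w, rfl⟩ := (shear μ 0).surjective z
    obtain ⟨a, ha⟩ := exists_mem_convexHull_vertices w
    exact ⟨a, shear_mem_convexHull _ _ ha⟩

end Rows

section Moments

theorem verticalMoment_fanTriangle_left (k : Fin 5) :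
    verticalMoment (fanTriangle leftApex leftRim k) =
      ![6 / 5 + 2 * √5 / 5, 44 / 45 + 4 * √5 / 15, 8 / 15, 44 / 45 - 4 * √5 / 15,
        6 / 5 - 2 * √5 / 5] k := by
  fin_cases k <;> simp [verticalMoment, Fin.sum_univ_three, fanTriangle, leftApex, leftRim] <;>
    linarith [sqrt_five_sq]

theorem strictAnti_verticalMoment_left :
    StrictAnti fun k => verticalMoment (fanTriangle leftApex leftRim k) := by
  rw [Fin.strictAnti_iff_succ_lt]
  have h2 := two_lt_sqrt_five
  have h3 := sqrt_five_lt_three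
  intro k
  simp only [verticalMoment_fanTriangle_left]
  fin_cases k <;> simp <;> linarith

theorem verticalMoment_fanTriangle_right (n : ℕ) (m : Fin n) :
    verticalMoment (fanTriangle rightApex (rightFeet n) m) = 4 := by
  simp [verticalMoment, Fin.sum_univ_three, fanTriangle, rightApex, rightFeet]; norm_num

theorem mixedMoment_fanTriangle_right (n : ℕ) (m : Fin n) :
    mixedMoment (fanTriangle rightApex (rightFeet n) m) = 8 * √5 - 4 - 8 * m := by
  simp [mixedMoment, Fin.sum_univ_three, fanTriangle, rightApex, rightFeet]; ring

theorem verticalMoment_left_mem_Ioo (k : Fin 5) :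
    verticalMoment (fanTriangle leftApex leftRim k) ∈ Set.Ioo 0 4 := by
  have h2 := two_lt_sqrt_five
  have h3 := sqrt_five_lt_three
  rw [verticalMoment_fanTriangle_left]
  fin_cases k <;> constructor <;> simp <;> linarith

theorem eq_of_moments_prototile_eq {n n' : ℕ} {i : Fin 5 ⊕ Fin n} {i' : Fin 5 ⊕ Fin n'}
    {o o' : ℝ} (ho : o ∈ Set.Ico 0 1) (ho' : o' ∈ Set.Ico 0 1)
    (hv : verticalMoment (prototile n i) = verticalMoment (prototile n' i'))
    (hm : mixedMoment (prototile n i) + 2 * o * verticalMoment (prototile n i) =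
      mixedMoment (prototile n' i') + 2 * o' * verticalMoment (prototile n' i')) :
    o = o' ∧ i.map id Fin.val = i'.map id Fin.val := by
  obtain ⟨ho0, ho1⟩ := ho
  obtain ⟨ho0', ho1'⟩ := ho'
  rcases i with k | m <;> rcases i' with k' | m' <;> simp only [prototile, Sum.elim_inl,
    Sum.elim_inr] at hv hm
  · obtain rfl := strictAnti_verticalMoment_left.injective hv
    have hpos := (verticalMoment_left_mem_Ioo k).1
    exact ⟨by nlinarith, rfl⟩
  · rw [verticalMoment_fanTriangle_right] at hv
    exact absurd hv (verticalMoment_left_mem_Ioo k).2.ne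
  · rw [verticalMoment_fanTriangle_right] at hv
    exact absurd hv (verticalMoment_left_mem_Ioo k').2.ne'
  · simp only [verticalMoment_fanTriangle_right, mixedMoment_fanTriangle_right] at hm
    have hlt : (m : ℕ) < m' + 1 := by exact_mod_cast (by linarith : (m : ℝ) < m' + 1)
    have hgt : (m' : ℕ) < m + 1 := by exact_mod_cast (by linarith : (m' : ℝ) < m + 1)
    have heq : (m : ℕ) = m' := by lia
    exact ⟨by rw [heq] at hm; linarith, congrArg Sum.inr heq⟩

theorem injective_moments_vertices :
    Function.Injective fun a => (verticalMoment (vertices a), mixedMoment (vertices a)) := by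
  rintro ⟨⟨j, p⟩, i⟩ ⟨⟨j', p'⟩, i'⟩ h
  simp only [vertices, place, verticalMoment_shear, mixedMoment_shear, Prod.mk.injEq] at h
  obtain ⟨hoffset, hi⟩ := eq_of_moments_prototile_eq ⟨offset_nonneg _ _, offset_lt_one _ _⟩
    ⟨offset_nonneg _ _, offset_lt_one _ _⟩ h.1 h.2
  obtain ⟨rfl, rfl⟩ := eq_of_offset_rowShift_eq hoffset
  rw [Sum.map_injective.2 ⟨Function.injective_id, Fin.val_injective⟩ hi]

end Moments

section Existence

theorem dist_le_abs_sub_add_abs_sub (x y : Plane) : dist x y ≤ |x 0 - y 0| + |x 1 - y 1| := by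
  refine (sq_le_sq₀ dist_nonneg (by positivity)).1 ?_
  rw [dist_sq_eq, add_sq', sq_abs, sq_abs]
  exact le_add_of_nonneg_right (by positivity)

theorem dist_shear_vertices_le {μ : ℝ} (h0 : 0 ≤ μ) (h1 : μ ≤ 1) (a : TileIndex) (k l : Fin 3) :
    dist (shear μ 0 (vertices a k)) (shear μ 0 (vertices a l)) ≤ 14 := by
  obtain ⟨⟨j, p⟩, i⟩ := a
  have ho := offset_nonneg (rowShift j) p
  have ho' := offset_lt_one (rowShift j) p
  set ν := μ + 2 * offset (rowShift j) p
  obtain ⟨hx, hy, hy', hw⟩ := prototile_mem_block (fanSize (rowShift j) p) i k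
  obtain ⟨gx, gy, gy', gw⟩ := prototile_mem_block (fanSize (rowShift j) p) i l
  have hwidth := width_fanSize_lt (rowShift j) p hy hy'
  have gwidth := width_fanSize_lt (rowShift j) p gy gy'
  let w := prototile (fanSize (rowShift j) p) i
  have hdx : |w k 0 - w l 0| ≤ 10 := abs_sub_le_of_nonneg_of_le hx (by linarith) gx (by linarith)
  have hdy : |w k 1 - w l 1| ≤ 1 := abs_sub_le_of_nonneg_of_le hy hy' gy gy'
  have hν : |ν| ≤ 3 := abs_le.2 ⟨by linarith, by linarith⟩
  calc dist (shear μ 0 (place j p (w k))) (shear μ 0 (place j p (w l)))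
      ≤ |(w k 0 - w l 0) + ν * (w k 1 - w l 1)| + |w k 1 - w l 1| := by
        convert dist_le_abs_sub_add_abs_sub _ _ using 3 <;> simp [place, ν]; ring
    _ ≤ |w k 0 - w l 0| + |ν| * |w k 1 - w l 1| + |w k 1 - w l 1| := by
        rw [← abs_mul]; gcongr; exact abs_add_le _ _
    _ ≤ 10 + 3 * 1 + 1 := by gcongr
    _ = 14 := by norm_num

theorem exists_isUnitTriangleTiling_pairwise_not_areCongruent :
    ∃ 𝒯 : Set (Set Plane), IsUnitTriangleTiling 𝒯 ∧
      (∀ S ∈ 𝒯, ∀ T ∈ 𝒯, S ≠ T → ¬ AreCongruent S T) ∧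
      ∀ T ∈ 𝒯, ∃ p : ℝ, HasPerimeter T p ∧ p < 100 := by
  obtain ⟨μ, ⟨hμ0, hμ1⟩, hinj⟩ := exists_shear_injective_sumSqDist injective_moments_vertices
    zero_lt_one
  have htiling := isUnitTriangleTiling_range_shear μ
  have hindep : ∀ a, AffineIndependent ℝ (shear μ 0 ∘ vertices a) := fun a =>
    affineIndependent_of_orient_ne_zero (by simp [orient_vertices])
  refine ⟨_, htiling, ?_, ?_⟩
  · rintro _ ⟨a, rfl⟩ _ ⟨b, rfl⟩ hne ⟨f, hf⟩
    exact hne (congrArg (fun a => convexHull ℝ (Set.range (shear μ 0 ∘ vertices a))) (hinj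
      (sumSqDist_eq_of_image_convexHull_eq (hindep a) (hindep b) f hf)))
  · rintro T ⟨a, rfl⟩
    have hball : convexHull ℝ (Set.range (shear μ 0 ∘ vertices a)) ⊆
        Metric.closedBall (shear μ 0 (vertices a 0)) 14 := by
      refine convexHull_min ?_ (convex_closedBall _ _)
      rintro _ ⟨k, rfl⟩
      exact dist_shear_vertices_le hμ0.le hμ1.le a k 0
    obtain ⟨p, hp, hp'⟩ := (htiling.2 _ ⟨a, rfl⟩).1.exists_hasPerimeter_le hball
    exact ⟨p, hp, by linarith⟩

end Existence

end PlaneTiling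

theorem mainTheorem1_general :
    (∃ 𝒯 : Set (Set PlaneTiling.Plane),
      PlaneTiling.IsUnitTriangleTiling 𝒯 ∧
      PlaneTiling.IsNormal 𝒯 ∧
      (∀ S ∈ 𝒯, ∀ T ∈ 𝒯, S ≠ T → ¬ PlaneTiling.AreCongruent S T) ∧
      (∀ T ∈ 𝒯, ∃ p : ℝ, PlaneTiling.HasPerimeter T p ∧ p < 100)) ∧
    (∀ (𝒯 : Set (Set PlaneTiling.Plane)) (a : ℝ), 0 < a →
      (∀ T ∈ 𝒯, PlaneTiling.IsTriangle T ∧ ENNReal.ofReal a ≤ MeasureTheory.volume T) →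
      (PlaneTiling.IsNormal 𝒯 ↔
        ∃ c : ℝ, ∀ T ∈ 𝒯, ∃ p : ℝ, PlaneTiling.HasPerimeter T p ∧ p ≤ c)) := by
  refine ⟨?_, fun 𝒯 a ha h𝒯 => PlaneTiling.isNormal_iff_exists_perimeter_le ha h𝒯⟩
  obtain ⟨𝒯, htiling, hcongruent, hperimeter⟩ :=
    PlaneTiling.exists_isUnitTriangleTiling_pairwise_not_areCongruent
  have hnormal : PlaneTiling.IsNormal 𝒯 :=
    (PlaneTiling.isNormal_iff_exists_perimeter_le one_pos fun T hT =>
      (htiling.2 T hT).imp_right fun hvol => by simp [hvol]).2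
      ⟨100, fun T hT => (hperimeter T hT).imp fun _ hp => hp.imp_right le_of_lt⟩
  exact ⟨𝒯, htiling, hnormal, hcongruent, hperimeter⟩

theorem mainTheorem1 :
    (∃ 𝒯 : Set (Set PlaneTiling.Plane),
      PlaneTiling.IsUnitTriangleTiling 𝒯 ∧
      PlaneTiling.IsNormal 𝒯 ∧
      (∀ S ∈ 𝒯, ∀ T ∈ 𝒯, S ≠ T → ¬ PlaneTiling.AreCongruent S T) ∧
      (∀ T ∈ 𝒯, ∃ p : ℝ, PlaneTiling.HasPerimeter T p ∧ p < 100)) ∧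
    (∀ 𝒯 : Set (Set PlaneTiling.Plane), PlaneTiling.IsUnitTriangleTiling 𝒯 →
      (PlaneTiling.IsNormal 𝒯 ↔
        ∃ c : ℝ, ∀ T ∈ 𝒯, ∃ p : ℝ, PlaneTiling.HasPerimeter T p ∧ p ≤ c)) :=
  ⟨mainTheorem1_general.1, fun 𝒯 h => mainTheorem1_general.2 𝒯 1 one_pos fun T hT =>
    (h.2 T hT).imp_right fun hvol => by simp [hvol]⟩
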